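/- For every positive integer $n$ there exist $n$ cyclic quadrilaterals in the Euclidean plane, all of whose sides have integer length, which all have the same perimeter and the same integer area, and whose (unordered) quadruples of side lengths are pairwise distinct. Here a cyclic quadrilateral is one whose four vertices are distinct points lying, in the order in which they are joined, on a circle (so that it is convex); its diagonals are not required to have integer length. -/

import Mathlib

open MeasureTheory

/-- The Euclidean plane. -/
abbrev Plane : Type := EuclideanSpace ℝ (Fin 2)

namespace Quadrilateral

/-- The quadrilateral with consecutive vertices `Q 0, Q 1, Q 2, Q 3` is cyclic: the vertices are
four distinct points of a circle, and they are met in this order when going round the circle.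
For four distinct points of a circle the latter says exactly that the diagonals
`Q 0 Q 2` and `Q 1 Q 3` meet (that is, the quadrilateral is convex and does not cross itself). -/
structure IsCyclicQuad (Q : Polygon Plane 4) : Prop where
  injective : Function.Injective Q.vertices
  cospherical : EuclideanGeometry.Cospherical (Set.range Q.vertices)
  diagonals_meet : (segment ℝ (Q 0) (Q 2) ∩ segment ℝ (Q 1) (Q 3)).Nonempty

/-- The length of the side from vertex `j` to the next vertex (indices modulo `4`). -/
noncomputable def side (Q : Polygon Plane 4) (j : Fin 4) : ℝ := dist (Q j) (Q (j + 1))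

/-- The four side lengths, without regard to order. -/
noncomputable def sides (Q : Polygon Plane 4) : Multiset ℝ :=
  (Finset.univ : Finset (Fin 4)).val.map (side Q)

noncomputable def perimeter (Q : Polygon Plane 4) : ℝ := ∑ j, side Q j

/-- The area of a convex quadrilateral: the Lebesgue measure of the region it bounds,
which is the convex hull of its vertices. -/
noncomputable def area (Q : Polygon Plane 4) : ENNReal :=
  volume (convexHull ℝ (Set.range Q.vertices))

end Quadrilateral

/-! By Brahmagupta, a cyclic quadrilateral with sides h - x_j, where ∑ x_j = 2h, has perimeter 2h
and area √(x_0 x_1 x_2 x_3); it exists as soon as 0 < x_j < h (`exists_isCyclicQuad`). So it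
suffices to find infinitely many positive rational quadruples with a fixed sum and a fixed square
product, all satisfying x_j < h, and to clear the denominators of n of them. The bound x_j < h is
automatic when the product is large enough (`posQuads_lt_half`).

Write a quadruple as a 2×2 matrix with rows (x_0, x_1), (x_2, x_3). Rescaling the rows so that their
sums are interchanged preserves the total sum and the product; `quadStep` does this and then gives
the matrix a quarter turn, so that the next step acts on the former columns.

Let f be the square of `quadStep`. Its displacement f(x) - x vanishes to second order at (1,1,1,1)
(`quadStep_quadStep_sub`), hence is 1/9-Lipschitz on the 3-adic quadruples congruent to 1 modulo 9.
As 1/9 < |3|, the term 3(f(x) - x) dominates f³(x) - x, and by induction |f^(3^j)(x) - x| = 3^(-j)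
|f(x) - x| (`norm_iterate_pow_sub`). A point not fixed by f therefore has an infinite orbit, and
(17², 19², 26², 28²) is such a point. -/

namespace Quadrilateral

/-! ### Area of a convex quadrilateral from its diagonals -/

/-- The convex quadrilateral with vertices `(α, 0), (0, β), (-γ, 0), (0, -δ)`. -/
def axisRegion (α β γ δ : ℝ) : Set (ℝ × ℝ) :=
  {p | max (p.1 / α) (-p.1 / γ) + max (p.2 / β) (-p.2 / δ) ≤ 1}

theorem max_div_neg_div_le_iff {β δ g t : ℝ} (hβ : 0 < β) (hδ : 0 < δ) :
    max (t / β) (-t / δ) ≤ g ↔ t ∈ Set.Icc (-(δ * g)) (β * g) := by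
  rw [max_le_iff, div_le_iff₀ hβ, div_le_iff₀ hδ, Set.mem_Icc]
  constructor
  · rintro ⟨h₁, h₂⟩; constructor <;> linarith
  · rintro ⟨h₁, h₂⟩; constructor <;> linarith

theorem measurableSet_axisRegion (α β γ δ : ℝ) : MeasurableSet (axisRegion α β γ δ) := by
  refine IsClosed.measurableSet (isClosed_le ?_ continuous_const)
  fun_prop

theorem integral_one_sub_max {α γ : ℝ} (hα : 0 < α) (hγ : 0 < γ) :
    ∫ s in (-γ)..α, (1 - max (s / α) (-s / γ)) = (α + γ) / 2 := by
  have hc : Continuous fun s : ℝ => 1 - max (s / α) (-s / γ) := by fun_prop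
  rw [← intervalIntegral.integral_add_adjacent_intervals (b := 0)
    (hc.intervalIntegrable _ _) (hc.intervalIntegrable _ _)]
  have h₁ : ∫ s in (-γ)..0, (1 - max (s / α) (-s / γ)) = ∫ s in (-γ)..0, (1 + s / γ) := by
    refine intervalIntegral.integral_congr fun s hs => ?_
    rw [Set.uIcc_of_le (by linarith)] at hs
    have a₁ : s / α ≤ 0 := div_nonpos_of_nonpos_of_nonneg hs.2 hα.le
    have a₂ : 0 ≤ -s / γ := div_nonneg (by linarith [hs.2]) hγ.le
    simp only [max_eq_right (a₁.trans a₂)]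
    ring
  have h₂ : ∫ s in (0 : ℝ)..α, (1 - max (s / α) (-s / γ)) = ∫ s in (0 : ℝ)..α, (1 - s / α) := by
    refine intervalIntegral.integral_congr fun s hs => ?_
    rw [Set.uIcc_of_le hα.le] at hs
    have a₁ : 0 ≤ s / α := div_nonneg hs.1 hα.le
    have a₂ : -s / γ ≤ 0 := div_nonpos_of_nonpos_of_nonneg (by linarith [hs.1]) hγ.le
    simp only [max_eq_left (a₂.trans a₁)]
  rw [h₁, h₂, intervalIntegral.integral_add (by simp) (by simp),
    intervalIntegral.integral_sub (by simp) (by simp)]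
  simp only [intervalIntegral.integral_div, integral_id, intervalIntegral.integral_const,
    smul_eq_mul]
  field_simp
  ring

theorem volume_axisRegion {α β γ δ : ℝ} (hα : 0 < α) (hβ : 0 < β) (hγ : 0 < γ) (hδ : 0 < δ) :
    volume (axisRegion α β γ δ) = ENNReal.ofReal ((α + γ) * (β + δ) / 2) := by
  rw [Measure.volume_eq_prod, Measure.prod_apply (measurableSet_axisRegion α β γ δ)]
  have hslice (s : ℝ) : volume (Prod.mk s ⁻¹' axisRegion α β γ δ) =
      ENNReal.ofReal ((β + δ) * (1 - max (s / α) (-s / γ))) := by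
    have : Prod.mk s ⁻¹' axisRegion α β γ δ = Set.Icc (-(δ * (1 - max (s / α) (-s / γ))))
        (β * (1 - max (s / α) (-s / γ))) := by
      ext t
      rw [← max_div_neg_div_le_iff hβ hδ, le_sub_iff_add_le']
      rfl
    rw [this, Real.volume_Icc]
    congr 1
    ring
  simp_rw [hslice]
  -- Outside the interval the slice is null: the length formula is nonpositive there and
  -- `ENNReal.ofReal` truncates it to 0.
  have hsupp : (fun s : ℝ => ENNReal.ofReal ((β + δ) * (1 - max (s / α) (-s / γ)))) =
      (Set.Ioc (-γ) α).indicator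
        fun s => ENNReal.ofReal ((β + δ) * (1 - max (s / α) (-s / γ))) := by
    ext s
    by_cases hs : s ∈ Set.Ioc (-γ) α
    · rw [Set.indicator_of_mem hs]
    · rw [Set.indicator_of_notMem hs, ENNReal.ofReal_eq_zero]
      refine mul_nonpos_of_nonneg_of_nonpos (by positivity) ?_
      rw [sub_nonpos, le_max_iff, le_div_iff₀ hα, le_div_iff₀ hγ]
      by_contra! h
      exact hs ⟨by linarith [h.2], by linarith [h.1]⟩
  have hc : Continuous fun s : ℝ => (β + δ) * (1 - max (s / α) (-s / γ)) := by fun_prop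
  rw [hsupp, lintegral_indicator measurableSet_Ioc, ← ofReal_integral_eq_lintegral_ofReal
    (hc.integrableOn_Ioc) ?_, ← intervalIntegral.integral_of_le (by linarith),
    intervalIntegral.integral_const_mul, integral_one_sub_max hα hγ]
  · congr 1
    ring
  · refine (ae_restrict_iff' measurableSet_Ioc).2 (Filter.Eventually.of_forall fun s hs => ?_)
    refine mul_nonneg (by positivity) ?_
    rw [sub_nonneg, max_le_iff, div_le_iff₀ hα, div_le_iff₀ hγ]
    exact ⟨by linarith [hs.2], by linarith [hs.1]⟩

theorem convex_axisRegion {α β γ δ : ℝ} :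
    Convex ℝ (axisRegion α β γ δ) := by
  have hl (f : ℝ × ℝ →ₗ[ℝ] ℝ) : ConvexOn ℝ Set.univ f := f.convexOn convex_univ
  have h (f : ℝ × ℝ →ₗ[ℝ] ℝ) (a b : ℝ) :
      ConvexOn ℝ Set.univ fun p => max (f p / a) (-f p / b) := by
    have := (hl (a⁻¹ • f)).sup (hl (-b⁻¹ • f))
    refine this.congr fun p _ => ?_
    simp [div_eq_inv_mul]
  have := ((h (LinearMap.fst ℝ ℝ ℝ) α γ).add (h (LinearMap.snd ℝ ℝ ℝ) β δ)).convex_le 1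
  simpa [axisRegion] using this

theorem mem_segment_axis {α γ s g : ℝ} (hα : 0 < α) (hγ : 0 < γ)
    (h : max (s / α) (-s / γ) ≤ g) :
    ∃ u v, 0 ≤ u ∧ 0 ≤ v ∧ u + v = g ∧ s = u * α - v * γ := by
  rw [max_div_neg_div_le_iff hα hγ] at h
  refine ⟨(s + g * γ) / (α + γ), (g * α - s) / (α + γ), ?_, ?_, ?_, ?_⟩
  · exact div_nonneg (by linarith [h.1]) (by positivity)
  · exact div_nonneg (by linarith [h.2]) (by positivity)
  · field_simp; ring
  · field_simp; ring

theorem convexHull_axis {α β γ δ : ℝ} (hα : 0 < α) (hβ : 0 < β) (hγ : 0 < γ) (hδ : 0 < δ) :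
    convexHull ℝ {((α, 0) : ℝ × ℝ), (0, β), (-γ, 0), (0, -δ)} = axisRegion α β γ δ := by
  apply Set.Subset.antisymm
  · refine convexHull_min ?_ convex_axisRegion
    have e (a b : ℝ) (ha : 0 < a) (hb : 0 < b) :
        max (a / a) (-a / b) = 1 ∧ max (-b / a) (b / b) = 1 := by
      rw [div_self ha.ne', div_self hb.ne', max_eq_left, max_eq_right]
      · exact ⟨rfl, rfl⟩
      · exact (div_nonpos_of_nonpos_of_nonneg (by linarith) ha.le).trans zero_le_one
      · exact (div_nonpos_of_nonpos_of_nonneg (by linarith) hb.le).trans zero_le_one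
    rintro p (rfl | rfl | rfl | rfl) <;>
      simp [axisRegion, (e _ _ hα hγ).1, (e _ _ hα hγ).2, (e _ _ hβ hδ).1, (e _ _ hβ hδ).2]
  · rintro ⟨s, t⟩ h
    have h' : max (s / α) (-s / γ) + max (t / β) (-t / δ) ≤ 1 := h
    -- The second pair of weights absorbs all the slack, so the four weights sum to exactly 1.
    obtain ⟨u, v, hu, hv, huv, hs⟩ := mem_segment_axis hα hγ le_rfl (s := s)
    obtain ⟨u', v', hu', hv', huv', ht⟩ := mem_segment_axis hβ hδ
      (le_sub_iff_add_le'.2 h') (s := t)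
    have hc := convex_convexHull ℝ {((α, 0) : ℝ × ℝ), (0, β), (-γ, 0), (0, -δ)}
    have hm := hc.sum_mem (t := Finset.univ) (w := ![u, u', v, v'])
      (z := ![(α, 0), (0, β), (-γ, 0), (0, -δ)]) ?_ ?_ ?_
    · convert hm using 1
      simp [Fin.sum_univ_four, hs, ht, sub_eq_add_neg]
    · intro i _; fin_cases i <;> simpa
    · simp [Fin.sum_univ_four]; linarith
    · intro i _
      apply subset_convexHull
      fin_cases i <;> simp

/-- The linear map from `ℝ × ℝ` to the plane that sends the standard basis to `(1, 0), (c, s)`. -/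
noncomputable def obliqueMap (c s : ℝ) : ℝ × ℝ →ₗ[ℝ] Plane where
  toFun p := !₂[p.1 + p.2 * c, p.2 * s]
  map_add' p q := by ext i; fin_cases i <;> simp <;> ring
  map_smul' r p := by ext i; fin_cases i <;> simp <;> ring

theorem volume_image_obliqueMap (c : ℝ) {s : ℝ} (hs : 0 < s) (K : Set (ℝ × ℝ)) :
    volume (obliqueMap c s '' K) = ENNReal.ofReal s * volume K := by
  let e : Plane ≃ᵐ ℝ × ℝ := (MeasurableEquiv.toLp 2 (Fin 2 → ℝ)).symm.trans
    MeasurableEquiv.finTwoArrow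
  have he : MeasurePreserving e :=
    (volume_preserving_finTwoArrow ℝ).comp
      (EuclideanSpace.volume_preserving_symm_measurableEquiv_toLp (Fin 2))
  let f : Plane →ₗ[ℝ] Plane := Matrix.toLin (PiLp.basisFun 2 ℝ (Fin 2))
    (PiLp.basisFun 2 ℝ (Fin 2)) !![1, c; 0, s]
  have hf : obliqueMap c s '' K = f '' (e ⁻¹' K) := by
    have : ∀ x : Plane, f x = obliqueMap c s (e x) := by
      intro x
      have h0 : e x = (x 0, x 1) := rfl
      rw [h0]
      ext i
      fin_cases i <;>
        simp [f, obliqueMap, Matrix.toLin_apply, Matrix.mulVec, dotProduct, Fin.sum_univ_two] <;>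
          ring
    ext y
    constructor
    · rintro ⟨p, hp, rfl⟩
      refine ⟨e.symm p, by simpa using hp, ?_⟩
      rw [this, e.apply_symm_apply]
    · rintro ⟨x, hx, rfl⟩
      exact ⟨e x, hx, (this x).symm⟩
  rw [hf, Measure.addHaar_image_linearMap, he.measure_preimage_equiv]
  congr 2
  simp [f, LinearMap.det_toLin, abs_of_pos hs]

end Quadrilateral

/-! ### Cyclic quadrilaterals with given sides -/

namespace Quadrilateral

/-- The quadrilateral whose diagonals meet at the origin with angle of cosine `c` and sine `s`,
and whose vertices have distances `α, β, γ, δ` from the origin. -/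
noncomputable def diagonalQuad (c s α β γ δ : ℝ) : Polygon Plane 4 :=
  ⟨![obliqueMap c s (α, 0), obliqueMap c s (0, β), obliqueMap c s (-γ, 0), obliqueMap c s (0, -δ)]⟩

theorem dist_obliqueMap (c s : ℝ) (p q : ℝ × ℝ) :
    dist (obliqueMap c s p) (obliqueMap c s q) =
      √((p.1 - q.1 + (p.2 - q.2) * c) ^ 2 + ((p.2 - q.2) * s) ^ 2) := by
  rw [EuclideanSpace.dist_eq, Fin.sum_univ_two, Real.dist_eq, Real.dist_eq, sq_abs, sq_abs]
  congr 2
  · simp [obliqueMap]; ring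
  · simp [obliqueMap]; ring

theorem obliqueMap_injective (c : ℝ) {s : ℝ} (hs : s ≠ 0) :
    Function.Injective (obliqueMap c s) := by
  intro p q h
  have h0 := congrArg (fun x : Plane => x 0) h
  have h1 := congrArg (fun x : Plane => x 1) h
  simp only [obliqueMap, LinearMap.coe_mk, AddHom.coe_mk, PiLp.toLp_apply, Matrix.cons_val_zero,
    Matrix.cons_val_one, mul_eq_mul_right_iff, hs, or_false] at h0 h1
  rw [h1] at h0
  exact Prod.ext (by linarith) h1

variable {c s α β γ δ : ℝ}

theorem range_diagonalQuad : Set.range (diagonalQuad c s α β γ δ).vertices =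
    obliqueMap c s '' {((α, 0) : ℝ × ℝ), (0, β), (-γ, 0), (0, -δ)} := by
  simp only [diagonalQuad, Matrix.range_cons, Matrix.range_empty, Set.union_empty,
    Set.image_insert_eq, Set.image_singleton, Set.singleton_union]

theorem zero_mem_segment_obliqueMap {p : ℝ × ℝ} {u v : ℝ} (hu : 0 < u) (hv : 0 < v) :
    (0 : Plane) ∈ segment ℝ (obliqueMap c s (u • p)) (obliqueMap c s (-v • p)) := by
  refine ⟨v / (u + v), u / (u + v), by positivity, by positivity, by field_simp; ring, ?_⟩
  rw [map_smul, map_smul, smul_smul, smul_smul, ← add_smul]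
  convert zero_smul ℝ _
  ring

/-- Converse of the intersecting chords theorem: α * γ = β * δ makes the four points concyclic. -/
theorem isCyclicQuad_diagonalQuad (hα : 0 < α) (hβ : 0 < β) (hγ : 0 < γ) (hδ : 0 < δ)
    (hs : 0 < s) (hcs : c ^ 2 + s ^ 2 = 1) (h : α * γ = β * δ) :
    IsCyclicQuad (diagonalQuad c s α β γ δ) where
  injective := by
    have hinj : Function.Injective ![((α, 0) : ℝ × ℝ), (0, β), (-γ, 0), (0, -δ)] := by
      intro i j hij
      fin_cases i <;> fin_cases j <;> simp at hij ⊢ <;> linarith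
    convert (obliqueMap_injective c hs.ne').comp hinj using 1
    ext i : 1
    fin_cases i <;> rfl
  cospherical := by
    -- The centre projects onto the midpoints of both diagonals, and the origin has power -α * γ
    -- with respect to the circle.
    set q : ℝ := ((β - δ) / 2 - (α - γ) / 2 * c) / s with hq
    have hqs : q * s = (β - δ) / 2 - (α - γ) / 2 * c := by rw [hq]; field_simp
    refine ⟨!₂[(α - γ) / 2, q], √(((α - γ) / 2) ^ 2 + q ^ 2 + α * γ), ?_⟩
    rw [range_diagonalQuad]
    have key (x y : ℝ) : dist (obliqueMap c s (x, y)) !₂[(α - γ) / 2, q] =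
        √(((α - γ) / 2) ^ 2 + q ^ 2 +
          (x ^ 2 + y ^ 2 + 2 * x * y * c - x * (α - γ) - y * (β - δ))) := by
      rw [EuclideanSpace.dist_eq, Fin.sum_univ_two, Real.dist_eq, Real.dist_eq, sq_abs, sq_abs]
      congr 1
      simp only [obliqueMap, LinearMap.coe_mk, AddHom.coe_mk, PiLp.toLp_apply,
        Matrix.cons_val_zero, Matrix.cons_val_one]
      linear_combination y ^ 2 * hcs - 2 * y * hqs
    rintro _ ⟨p, rfl | rfl | rfl | rfl, rfl⟩ <;> rw [key] <;> congr 2 <;> linarith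
  diagonals_meet := by
    refine ⟨0, ?_, ?_⟩
    · simpa [diagonalQuad] using zero_mem_segment_obliqueMap (c := c) (s := s) (p := (1, 0)) hα hγ
    · simpa [diagonalQuad] using zero_mem_segment_obliqueMap (c := c) (s := s) (p := (0, 1)) hβ hδ

theorem area_diagonalQuad (hα : 0 < α) (hβ : 0 < β) (hγ : 0 < γ) (hδ : 0 < δ) (hs : 0 < s) :
    area (diagonalQuad c s α β γ δ) = ENNReal.ofReal (s * ((α + γ) * (β + δ) / 2)) := by
  rw [area, range_diagonalQuad, ← LinearMap.image_convexHull, convexHull_axis hα hβ hγ hδ,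
    volume_image_obliqueMap c hs, volume_axisRegion hα hβ hγ hδ, ENNReal.ofReal_mul hs.le]

/-- Existence of a cyclic quadrilateral with given sides, together with Brahmagupta's formula. -/
theorem exists_isCyclicQuad {a b c d : ℝ} (ha : 0 < a) (hb : 0 < b) (hc : 0 < c) (hd : 0 < d)
    (ha' : a < b + c + d) (hb' : b < a + c + d) (hc' : c < a + b + d) (hd' : d < a + b + c) :
    ∃ Q : Polygon Plane 4, IsCyclicQuad Q ∧ side Q 0 = a ∧ side Q 1 = b ∧ side Q 2 = c ∧
      side Q 3 = d ∧ area Q = ENNReal.ofReal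
        (√((b + c + d - a) * (a + c + d - b) * (a + b + d - c) * (a + b + c - d)) / 4) := by
  -- By similar triangles the half-diagonals are proportional to ad, ab, bc, cd. The law of cosines
  -- in the four triangles reduces to the two equations `hbd` and `hac`: their difference determines
  -- the cosine C, and then either one the scale k. By Ptolemy, m is the product of the diagonals.
  set m := a * c + b * d with hm
  have hm0 : 0 < m := by positivity
  set C := (b ^ 2 + d ^ 2 - a ^ 2 - c ^ 2) / (2 * m) with hC
  have hCm : C * (2 * m) = b ^ 2 + d ^ 2 - a ^ 2 - c ^ 2 := by rw [hC]; field_simp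
  set P := (b + c + d - a) * (a + c + d - b) * (a + b + d - c) * (a + b + c - d) with hP
  have hP0 : 0 < P := by
    have := sub_pos.2 ha'; have := sub_pos.2 hb'; have := sub_pos.2 hc'; have := sub_pos.2 hd'
    positivity
  set S := √P / (2 * m) with hS
  have hS0 : 0 < S := by positivity
  have hSm : S * (2 * m) = √P := by rw [hS]; field_simp
  have hCS : C ^ 2 + S ^ 2 = 1 := by
    have h1 : (C * (2 * m)) ^ 2 + (S * (2 * m)) ^ 2 = (2 * m) ^ 2 := by
      rw [hSm, Real.sq_sqrt hP0.le, hCm, hP, hm]; ring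
    have h2 : (C ^ 2 + S ^ 2) * (2 * m) ^ 2 = 1 * (2 * m) ^ 2 := by linarith
    exact mul_right_cancel₀ (by positivity) h2
  set k := √(m / ((a * b + c * d) * (a * d + b * c))) with hk
  have hk0 : 0 < k := by positivity
  have hk2 : k ^ 2 * ((a * b + c * d) * (a * d + b * c)) = m := by
    rw [hk, Real.sq_sqrt (by positivity)]; field_simp
  have hbd : k ^ 2 * (b ^ 2 + d ^ 2 - 2 * b * d * C) = 1 := by
    refine mul_right_cancel₀ hm0.ne' ?_
    linear_combination hk2 - k ^ 2 * b * d * hCm + k ^ 2 * (b ^ 2 + d ^ 2) * hm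
  have hac : k ^ 2 * (a ^ 2 + c ^ 2 + 2 * a * c * C) = 1 := by
    linear_combination hbd + k ^ 2 * hCm - 2 * k ^ 2 * C * hm
  refine ⟨diagonalQuad C S (k * (a * d)) (k * (a * b)) (k * (b * c)) (k * (c * d)),
    isCyclicQuad_diagonalQuad (by positivity) (by positivity) (by positivity) (by positivity)
      hS0 hCS (by ring), ?_, ?_, ?_, ?_, ?_⟩
  · refine (dist_obliqueMap _ _ _ _).trans ((congrArg _ ?_).trans (Real.sqrt_sq ha.le))
    linear_combination a ^ 2 * hbd + (k * (a * b)) ^ 2 * hCS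
  · refine (dist_obliqueMap _ _ _ _).trans ((congrArg _ ?_).trans (Real.sqrt_sq hb.le))
    linear_combination b ^ 2 * hac + (k * (a * b)) ^ 2 * hCS
  · refine (dist_obliqueMap _ _ _ _).trans ((congrArg _ ?_).trans (Real.sqrt_sq hc.le))
    linear_combination c ^ 2 * hbd + (k * (c * d)) ^ 2 * hCS
  · refine (dist_obliqueMap _ _ _ _).trans ((congrArg _ ?_).trans (Real.sqrt_sq hd.le))
    linear_combination d ^ 2 * hac + (k * (c * d)) ^ 2 * hCS
  · rw [area_diagonalQuad (by positivity) (by positivity) (by positivity) (by positivity) hS0]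
    congr 1
    linear_combination S / 2 * hk2 + hSm / 4

end Quadrilateral

/-! ### Iterating near-identity ultrametric maps -/

/-- `f` maps `B` to itself, and its displacement is `c`-Lipschitz there. -/
structure DisplacementLipschitz {E : Type*} [NormedAddCommGroup E] (B : Set E) (c : ℝ)
    (f : E → E) : Prop where
  mapsTo : Set.MapsTo f B B
  norm_sub_le : ∀ x ∈ B, ∀ y ∈ B, ‖(f x - x) - (f y - y)‖ ≤ c * ‖x - y‖

namespace DisplacementLipschitz

variable {E : Type*} [NormedAddCommGroup E] [IsUltrametricDist E] {B : Set E} {c : ℝ} {f g : E → E}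

theorem norm_map_sub_map_le (hf : DisplacementLipschitz B c f) (hc : c ≤ 1) {x y : E} (hx : x ∈ B)
    (hy : y ∈ B) : ‖f x - f y‖ ≤ ‖x - y‖ := by
  have h : f x - f y = ((f x - x) - (f y - y)) + (x - y) := by abel
  rw [h]
  refine (IsUltrametricDist.norm_add_le_max _ _).trans (max_le ?_ le_rfl)
  exact (hf.norm_sub_le x hx y hy).trans (mul_le_of_le_one_left (norm_nonneg _) hc)

theorem comp (hg : DisplacementLipschitz B c g) (hf : DisplacementLipschitz B c f) (hc₀ : 0 ≤ c)
    (hc : c ≤ 1) : DisplacementLipschitz B c (g ∘ f) where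
  mapsTo := hg.mapsTo.comp hf.mapsTo
  norm_sub_le x hx y hy := by
    have h : ((g ∘ f) x - x) - ((g ∘ f) y - y) =
        ((g (f x) - f x) - (g (f y) - f y)) + ((f x - x) - (f y - y)) := by
      simp only [Function.comp]; abel
    rw [h]
    refine (IsUltrametricDist.norm_add_le_max _ _).trans (max_le ?_ (hf.norm_sub_le x hx y hy))
    refine (hg.norm_sub_le _ (hf.mapsTo hx) _ (hf.mapsTo hy)).trans ?_
    exact mul_le_mul_of_nonneg_left (hf.norm_map_sub_map_le hc hx hy) hc₀

theorem iterate (hf : DisplacementLipschitz B c f) (hc₀ : 0 ≤ c) (hc : c ≤ 1) (n : ℕ) :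
    DisplacementLipschitz B c f^[n] := by
  induction n with
  | zero => exact ⟨fun x hx => hx, fun x _ y _ => by simpa using by positivity⟩
  | succ n ih => exact ih.comp hf hc₀ hc

theorem norm_iterate_sub_le (hf : DisplacementLipschitz B c f) (hc₀ : 0 ≤ c) (hc : c ≤ 1)
    (n : ℕ) {x : E} (hx : x ∈ B) : ‖f^[n] x - x‖ ≤ ‖f x - x‖ := by
  induction n with
  | zero => simp
  | succ n ih =>
    have h : f^[n + 1] x - x = (f^[n] (f x) - f^[n] x) + (f^[n] x - x) := by
      rw [Function.iterate_succ_apply]; abel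
    rw [h]
    refine (IsUltrametricDist.norm_add_le_max _ _).trans (max_le ?_ ih)
    exact (hf.iterate hc₀ hc n).norm_map_sub_map_le hc (hf.mapsTo hx) hx

/-- f^n(x) - x is a sum of n displacements, each within c * ‖f x - x‖ of the first; by the
ultrametric inequality these errors do not accumulate. -/
theorem norm_iterate_sub_nsmul_le (hf : DisplacementLipschitz B c f) (hc₀ : 0 ≤ c) (hc : c ≤ 1)
    (n : ℕ) {x : E} (hx : x ∈ B) :
    ‖f^[n] x - x - n • (f x - x)‖ ≤ c * ‖f x - x‖ := by
  induction n with
  | zero => simpa using by positivity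
  | succ n ih =>
    have h : f^[n + 1] x - x - (n + 1) • (f x - x) =
        (f^[n] x - x - n • (f x - x)) + ((f (f^[n] x) - f^[n] x) - (f x - x)) := by
      rw [Function.iterate_succ_apply', add_nsmul, one_nsmul]; abel
    rw [h]
    refine (IsUltrametricDist.norm_add_le_max _ _).trans (max_le ih ?_)
    refine (hf.norm_sub_le _ ((hf.iterate hc₀ hc n).mapsTo hx) _ hx).trans ?_
    exact mul_le_mul_of_nonneg_left (hf.norm_iterate_sub_le hc₀ hc n hx) hc₀

/-- Every iterate has the same displacement constant c, so the previous estimate applies to F =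
f^(p^j) with n = p: the main term has norm r * ‖F x - x‖, which exceeds the error because c < r. -/
theorem norm_iterate_pow_sub {p : ℕ} {r : ℝ} (hp : ∀ x : E, ‖p • x‖ = r * ‖x‖)
    (hf : DisplacementLipschitz B c f) (hc₀ : 0 ≤ c) (hc : c ≤ 1) (hcr : c < r)
    (j : ℕ) {x : E} (hx : x ∈ B) : ‖f^[p ^ j] x - x‖ = r ^ j * ‖f x - x‖ := by
  induction j with
  | zero => simp
  | succ j ih =>
    set F := f^[p ^ j] with hF
    have hFl := hf.iterate hc₀ hc (p ^ j)
    have key := hFl.norm_iterate_sub_nsmul_le hc₀ hc p hx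
    rw [pow_succ, Function.iterate_mul, pow_succ', mul_assoc, ← ih, ← hp]
    by_cases h0 : ‖F x - x‖ = 0
    · have : F^[p] x - x - p • (F x - x) = 0 := by
        rw [h0, mul_zero] at key
        exact norm_le_zero_iff.1 key
      rw [sub_eq_zero.1 this]
    · have hlt : ‖F^[p] x - x - p • (F x - x)‖ < ‖p • (F x - x)‖ := by
        rw [hp]
        exact key.trans_lt (mul_lt_mul_of_pos_right hcr ((norm_nonneg _).lt_of_ne' h0))
      have := IsUltrametricDist.norm_add_eq_max_of_norm_ne_norm hlt.ne
      rwa [sub_add_cancel, max_eq_right hlt.le] at this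

theorem iterate_pow_injective {p : ℕ} {r : ℝ} (hp : ∀ x : E, ‖p • x‖ = r * ‖x‖)
    (hf : DisplacementLipschitz B c f) (hc₀ : 0 ≤ c) (hcr : c < r) (hr : r < 1)
    {x : E} (hx : x ∈ B) (hfx : f x ≠ x) : Function.Injective fun j : ℕ => f^[p ^ j] x := by
  intro i j hij
  have h (j : ℕ) := hf.norm_iterate_pow_sub hp hc₀ (hcr.le.trans hr.le) hcr j hx
  have hpos : ‖f x - x‖ ≠ 0 := norm_ne_zero_iff.2 (sub_ne_zero.2 hfx)
  have hr0 : 0 < r := hc₀.trans_lt hcr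
  refine pow_right_injective₀ hr0 hr.ne (mul_right_cancel₀ hpos ?_)
  simp only [← h]
  exact congrArg (fun y => ‖y - x‖) hij

end DisplacementLipschitz

/-! ### The transformation of quadruples -/

/-- A transformation of quadruples that preserves their sum and their product. -/
def quadStep {K : Type*} [Field K] (x : Fin 4 → K) : Fin 4 → K :=
  ![x 2 * ((x 0 + x 1) / (x 2 + x 3)), x 0 * ((x 2 + x 3) / (x 0 + x 1)),
    x 3 * ((x 0 + x 1) / (x 2 + x 3)), x 1 * ((x 2 + x 3) / (x 0 + x 1))]

theorem map_quadStep {K L : Type*} [Field K] [Field L] (φ : K →+* L) (x : Fin 4 → K) :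
    φ ∘ quadStep x = quadStep (φ ∘ x) := by
  ext i
  fin_cases i <;> simp [quadStep]

/-- Quadruples of positive numbers with prescribed sum and product. -/
def posQuads (K : Type*) [Field K] [LinearOrder K] (S P : K) : Set (Fin 4 → K) :=
  {x | (∀ i, 0 < x i) ∧ ∑ i, x i = S ∧ ∏ i, x i = P}

theorem mapsTo_quadStep_posQuads {K : Type*} [Field K] [LinearOrder K] [IsStrictOrderedRing K]
    (S P : K) : Set.MapsTo quadStep (posQuads K S P) (posQuads K S P) := by
  rintro x ⟨hx, hS, hP⟩
  have := hx 0; have := hx 1; have := hx 2; have := hx 3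
  refine ⟨fun i => ?_, ?_, ?_⟩
  · fin_cases i <;> simp only [quadStep] <;> (simp; positivity)
  · rw [← hS]
    simp [quadStep, Fin.sum_univ_four]
    field_simp
    ring
  · rw [← hP]
    simp [quadStep, Fin.prod_univ_four]
    field_simp

/-! ### Ultrametric estimates near (1, 1, 1, 1) -/

section Lipschitz

variable {K : Type*} [NormedField K] [IsUltrametricDist K] {B : Set (Fin 4 → K)} {ε : ℝ}
  {F G : (Fin 4 → K) → K}

/-- `F` is bounded by `ε` and `1`-Lipschitz on `B`. -/
structure SmallLipschitz (B : Set (Fin 4 → K)) (ε : ℝ) (F : (Fin 4 → K) → K) : Prop where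
  norm_le : ∀ x ∈ B, ‖F x‖ ≤ ε
  norm_sub_le : ∀ x ∈ B, ∀ y ∈ B, ‖F x - F y‖ ≤ ‖x - y‖

namespace SmallLipschitz

theorem add (hF : SmallLipschitz B ε F) (hG : SmallLipschitz B ε G) :
    SmallLipschitz B ε fun x => F x + G x where
  norm_le x hx :=
    (IsUltrametricDist.norm_add_le_max _ _).trans (max_le (hF.norm_le x hx) (hG.norm_le x hx))
  norm_sub_le x hx y hy := by
    rw [add_sub_add_comm]
    exact (IsUltrametricDist.norm_add_le_max _ _).trans
      (max_le (hF.norm_sub_le x hx y hy) (hG.norm_sub_le x hx y hy))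

theorem norm_mul_sub_mul_le (hε₀ : 0 ≤ ε) (hF : SmallLipschitz B ε F) (hG : SmallLipschitz B ε G)
    {x y : Fin 4 → K} (hx : x ∈ B) (hy : y ∈ B) :
    ‖F x * G x - F y * G y‖ ≤ ε * ‖x - y‖ := by
  have h : F x * G x - F y * G y = F x * (G x - G y) + (F x - F y) * G y := by ring
  rw [h]
  refine (IsUltrametricDist.norm_add_le_max _ _).trans (max_le ?_ ?_)
  · rw [norm_mul]
    exact mul_le_mul (hF.norm_le x hx) (hG.norm_sub_le x hx y hy) (norm_nonneg _) hε₀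
  · rw [norm_mul, mul_comm]
    exact mul_le_mul (hG.norm_le y hy) (hF.norm_sub_le x hx y hy) (norm_nonneg _) hε₀

theorem mul (hF : SmallLipschitz B 1 F) (hG : SmallLipschitz B 1 G) :
    SmallLipschitz B 1 fun x => F x * G x where
  norm_le x hx := by
    rw [norm_mul]; exact mul_le_one₀ (hF.norm_le x hx) (norm_nonneg _) (hG.norm_le x hx)
  norm_sub_le x hx y hy := by
    simpa using norm_mul_sub_mul_le zero_le_one hF hG hx hy

omit [IsUltrametricDist K] in
theorem inv (hF : SmallLipschitz B 1 F) (h : ∀ x ∈ B, ‖F x‖ = 1) :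
    SmallLipschitz B 1 fun x => (F x)⁻¹ where
  norm_le x hx := by rw [norm_inv, h x hx, inv_one]
  norm_sub_le x hx y hy := by
    have h0 (x) (hx : x ∈ B) : F x ≠ 0 := norm_ne_zero_iff.1 (by rw [h x hx]; exact one_ne_zero)
    rw [inv_sub_inv (h0 x hx) (h0 y hy), norm_div, norm_mul, h x hx, h y hy, mul_one, div_one,
      norm_sub_rev]
    exact hF.norm_sub_le x hx y hy

theorem div (hF : SmallLipschitz B 1 F) (hG : SmallLipschitz B 1 G) (h : ∀ x ∈ B, ‖G x‖ = 1) :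
    SmallLipschitz B 1 fun x => F x / G x := by
  simpa only [div_eq_mul_inv] using hF.mul (hG.inv h)

/-- The Lipschitz constant of a product of two small functions and a bounded one is small. -/
theorem norm_mul_mul_sub_le {H : (Fin 4 → K) → K} (hε₀ : 0 ≤ ε) (hε : ε ≤ 1)
    (hF : SmallLipschitz B ε F) (hG : SmallLipschitz B ε G) (hH : SmallLipschitz B 1 H)
    {x y : Fin 4 → K} (hx : x ∈ B) (hy : y ∈ B) :
    ‖F x * G x * H x - F y * G y * H y‖ ≤ ε * ‖x - y‖ := by
  have h : F x * G x * H x - F y * G y * H y =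
      F x * G x * (H x - H y) + (F x * G x - F y * G y) * H y := by ring
  rw [h]
  refine (IsUltrametricDist.norm_add_le_max _ _).trans (max_le ?_ ?_)
  · rw [norm_mul, norm_mul]
    refine mul_le_mul ?_ (hH.norm_sub_le x hx y hy) (norm_nonneg _) hε₀
    exact (mul_le_of_le_one_right (norm_nonneg _) ((hG.norm_le x hx).trans hε)).trans
      (hF.norm_le x hx)
  · rw [norm_mul]
    exact (mul_le_of_le_one_right (norm_nonneg _) (hH.norm_le y hy)).trans
      (norm_mul_sub_mul_le hε₀ hF hG hx hy)

end SmallLipschitz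

/-- The quadruples all of whose entries are congruent to `1`. -/
def nearOne (K : Type*) [NormedField K] (ε : ℝ) : Set (Fin 4 → K) := {x | ∀ i, ‖x i - 1‖ ≤ ε}

variable {x y : Fin 4 → K}

theorem norm_eq_one_of_norm_sub_one_le {u : K} (hε : ε < 1) (hu : ‖u - 1‖ ≤ ε) : ‖u‖ = 1 := by
  have h := IsUltrametricDist.norm_add_eq_max_of_norm_ne_norm
    (x := u - 1) (y := 1) (by rw [norm_one]; exact (hu.trans_lt hε).ne)
  rwa [sub_add_cancel, norm_one, max_eq_right (hu.trans hε.le)] at h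

theorem norm_add_eq_one_of_nearOne (h2 : ‖(2 : K)‖ = 1) (hε : ε < 1) {u v : K}
    (hu : ‖u - 1‖ ≤ ε) (hv : ‖v - 1‖ ≤ ε) : ‖u + v‖ = 1 := by
  have hlt : ‖(u - 1) + (v - 1)‖ < ‖(2 : K)‖ :=
    h2 ▸ ((IsUltrametricDist.norm_add_le_max _ _).trans (max_le hu hv)).trans_lt hε
  have h := IsUltrametricDist.norm_add_eq_max_of_norm_ne_norm hlt.ne
  rw [max_eq_right hlt.le, h2] at h
  rw [← h]
  congr 1
  ring

theorem norm_mul_sub_one_le (hε₀ : ε < 1) {u v : K} (hu : ‖u - 1‖ ≤ ε) (hv : ‖v - 1‖ ≤ ε) :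
    ‖u * v - 1‖ ≤ ε := by
  have h : u * v - 1 = u * (v - 1) + (u - 1) := by ring
  rw [h]
  refine (IsUltrametricDist.norm_add_le_max _ _).trans (max_le ?_ hu)
  rwa [norm_mul, norm_eq_one_of_norm_sub_one_le hε₀ hu, one_mul]

theorem norm_add_div_add_sub_one_le (h2 : ‖(2 : K)‖ = 1) (hε : ε < 1) {u v u' v' : K}
    (hu : ‖u - 1‖ ≤ ε) (hv : ‖v - 1‖ ≤ ε) (hu' : ‖u' - 1‖ ≤ ε) (hv' : ‖v' - 1‖ ≤ ε) :
    ‖(u + v) / (u' + v') - 1‖ ≤ ε := by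
  have hn := norm_add_eq_one_of_nearOne h2 hε hu' hv'
  have h0 : u' + v' ≠ 0 := norm_ne_zero_iff.1 (by rw [hn]; exact one_ne_zero)
  have h : (u + v) / (u' + v') - 1 =
      (((u - 1) + (v - 1)) - ((u' - 1) + (v' - 1))) / (u' + v') := by
    field_simp; ring
  rw [h, norm_div, hn, div_one, sub_eq_add_neg]
  refine (IsUltrametricDist.norm_add_le_max _ _).trans (max_le ?_ ?_)
  · exact (IsUltrametricDist.norm_add_le_max _ _).trans (max_le hu hv)
  · rw [norm_neg]
    exact (IsUltrametricDist.norm_add_le_max _ _).trans (max_le hu' hv')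

theorem mapsTo_quadStep_nearOne (h2 : ‖(2 : K)‖ = 1) (hε : ε < 1) :
    Set.MapsTo quadStep (nearOne K ε) (nearOne K ε) := by
  intro x hx i
  fin_cases i <;> exact norm_mul_sub_one_le hε (hx _)
    (norm_add_div_add_sub_one_le h2 hε (hx _) (hx _) (hx _) (hx _))

theorem smallLipschitz_apply (hε : ε < 1) (i : Fin 4) :
    SmallLipschitz (nearOne K ε) 1 fun x => x i where
  norm_le _ hx := (norm_eq_one_of_norm_sub_one_le hε (hx i)).le
  norm_sub_le x _ y _ := norm_le_pi_norm (x - y) i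

theorem smallLipschitz_apply_sub_apply (i j : Fin 4) :
    SmallLipschitz (nearOne K ε) ε fun x => x i - x j where
  norm_le x hx := by
    rw [← sub_sub_sub_cancel_right _ _ 1, sub_eq_add_neg]
    refine (IsUltrametricDist.norm_add_le_max _ _).trans (max_le (hx i) ?_)
    rw [norm_neg]
    exact hx j
  norm_sub_le x _ y _ := by
    have h : x i - x j - (y i - y j) = (x - y) i + -(x - y) j := by
      simp only [Pi.sub_apply]; ring
    rw [h]
    refine (IsUltrametricDist.norm_add_le_max _ _).trans
      (max_le (norm_le_pi_norm _ i) ?_)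
    rw [norm_neg]
    exact norm_le_pi_norm _ j

theorem SmallLipschitz.inv_add_mul_add (h2 : ‖(2 : K)‖ = 1) (hε : ε < 1) (i j k l : Fin 4) :
    SmallLipschitz (nearOne K ε) 1 fun x => ((x i + x j) * (x k + x l))⁻¹ :=
  (((smallLipschitz_apply hε i).add (smallLipschitz_apply hε j)).mul
    ((smallLipschitz_apply hε k).add (smallLipschitz_apply hε l))).inv fun x hx => by
      rw [norm_mul, norm_add_eq_one_of_nearOne h2 hε (hx i) (hx j),
        norm_add_eq_one_of_nearOne h2 hε (hx k) (hx l), mul_one]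

theorem norm_quadStep_sub_quadStep_le (h2 : ‖(2 : K)‖ = 1) (hε : ε < 1) (hx : x ∈ nearOne K ε)
    (hy : y ∈ nearOne K ε) : ‖quadStep x - quadStep y‖ ≤ ‖x - y‖ := by
  have h (i j k l m : Fin 4) :=
    ((smallLipschitz_apply (K := K) hε i).mul (((smallLipschitz_apply hε j).add
      (smallLipschitz_apply hε k)).div ((smallLipschitz_apply hε l).add
        (smallLipschitz_apply hε m)) fun x hx =>
          norm_add_eq_one_of_nearOne h2 hε (hx l) (hx m))).norm_sub_le x hx y hy
  rw [pi_norm_le_iff_of_nonneg (norm_nonneg _)]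
  intro i
  fin_cases i
  · exact h 2 0 1 2 3
  · exact h 0 2 3 0 1
  · exact h 3 0 1 2 3
  · exact h 1 2 3 0 1

theorem smallLipschitz_det (hε : ε < 1) :
    SmallLipschitz (nearOne K ε) ε fun x => x 0 * x 3 - x 1 * x 2 where
  norm_le x hx := by
    rw [← sub_sub_sub_cancel_right _ _ 1, sub_eq_add_neg]
    refine (IsUltrametricDist.norm_add_le_max _ _).trans
      (max_le (norm_mul_sub_one_le hε (hx 0) (hx 3)) ?_)
    rw [norm_neg]
    exact norm_mul_sub_one_le hε (hx 1) (hx 2)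
  norm_sub_le x hx y hy := by
    have h₁ := ((smallLipschitz_apply hε 0).mul (smallLipschitz_apply hε 3)).norm_sub_le x hx y hy
    have h₂ := ((smallLipschitz_apply hε 1).mul (smallLipschitz_apply hε 2)).norm_sub_le x hx y hy
    rw [sub_sub_sub_comm, sub_eq_add_neg]
    refine (IsUltrametricDist.norm_add_le_max _ _).trans (max_le h₁ ?_)
    rwa [norm_neg]

/-- The displacement of the second iterate of `quadStep`, in terms of the intermediate point. -/
def quadDisplacement (z : Fin 4 → K) : Fin 4 → K :=
  ![(z 2 - z 1) * (z 0 * z 3 - z 1 * z 2) * ((z 2 + z 3) * (z 1 + z 3))⁻¹,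
    (z 3 - z 0) * (z 0 * z 3 - z 1 * z 2) * ((z 0 + z 1) * (z 1 + z 3))⁻¹,
    (z 0 - z 3) * (z 0 * z 3 - z 1 * z 2) * ((z 2 + z 3) * (z 0 + z 2))⁻¹,
    (z 1 - z 2) * (z 0 * z 3 - z 1 * z 2) * ((z 0 + z 1) * (z 0 + z 2))⁻¹]

/-- With z the intermediate point, f(x) comes from z through its row sums and x through its column
sums, since the step can be inverted. In the difference both z_i - z_j and the determinant factor
out, and both vanish at (1,1,1,1). -/
theorem quadStep_quadStep_sub (h2 : ‖(2 : K)‖ = 1) (hε : ε < 1) (hx : x ∈ nearOne K ε) :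
    quadStep (quadStep x) - x = quadDisplacement (quadStep x) := by
  have hne {w : Fin 4 → K} (hw : w ∈ nearOne K ε) (i j : Fin 4) : w i + w j ≠ 0 :=
    norm_ne_zero_iff.1 (by
      rw [norm_add_eq_one_of_nearOne h2 hε (hw i) (hw j)]; exact one_ne_zero)
  have h01 := hne hx 0 1
  have h23 := hne hx 2 3
  have hz := mapsTo_quadStep_nearOne h2 hε hx
  set z := quadStep x with hzdef
  have z0 : z 0 = x 2 * ((x 0 + x 1) / (x 2 + x 3)) := rfl
  have z1 : z 1 = x 0 * ((x 2 + x 3) / (x 0 + x 1)) := rfl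
  have z2 : z 2 = x 3 * ((x 0 + x 1) / (x 2 + x 3)) := rfl
  have z3 : z 3 = x 1 * ((x 2 + x 3) / (x 0 + x 1)) := rfl
  have s02 : z 0 + z 2 = x 0 + x 1 := by rw [z0, z2]; field_simp
  have s13 : z 1 + z 3 = x 2 + x 3 := by rw [z1, z3]; field_simp
  have x0 : x 0 = z 1 * ((z 0 + z 2) / (z 1 + z 3)) := by rw [s02, s13, z1]; field_simp
  have x1 : x 1 = z 3 * ((z 0 + z 2) / (z 1 + z 3)) := by rw [s02, s13, z3]; field_simp
  have x2 : x 2 = z 0 * ((z 1 + z 3) / (z 0 + z 2)) := by rw [s02, s13, z0]; field_simp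
  have x3 : x 3 = z 2 * ((z 1 + z 3) / (z 0 + z 2)) := by rw [s02, s13, z2]; field_simp
  clear_value z
  have := hne hz 0 1
  have := hne hz 2 3
  have := hne hz 0 2
  have := hne hz 1 3
  ext i
  fin_cases i
  · simp [quadStep, quadDisplacement, x0]; field_simp; ring
  · simp [quadStep, quadDisplacement, x1]; field_simp; ring
  · simp [quadStep, quadDisplacement, x2]; field_simp; ring
  · simp [quadStep, quadDisplacement, x3]; field_simp; ring

theorem norm_quadDisplacement_sub_le (h2 : ‖(2 : K)‖ = 1) (hε₀ : 0 ≤ ε) (hε : ε < 1)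
    (hx : x ∈ nearOne K ε) (hy : y ∈ nearOne K ε) :
    ‖quadDisplacement x - quadDisplacement y‖ ≤ ε * ‖x - y‖ := by
  have h (a b i j k l : Fin 4) := SmallLipschitz.norm_mul_mul_sub_le hε₀ hε.le
    (smallLipschitz_apply_sub_apply a b) (smallLipschitz_det (K := K) hε)
    (SmallLipschitz.inv_add_mul_add h2 hε i j k l) hx hy
  rw [pi_norm_le_iff_of_nonneg (by positivity)]
  intro i
  fin_cases i
  · exact h 2 1 2 3 1 3
  · exact h 3 0 0 1 1 3
  · exact h 0 3 2 3 0 2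
  · exact h 1 2 0 1 0 2

theorem displacementLipschitz_quadStep (h2 : ‖(2 : K)‖ = 1) (hε₀ : 0 ≤ ε) (hε : ε < 1) :
    DisplacementLipschitz (nearOne K ε) ε (quadStep ∘ quadStep) where
  mapsTo := (mapsTo_quadStep_nearOne h2 hε).comp (mapsTo_quadStep_nearOne h2 hε)
  norm_sub_le x hx y hy := by
    rw [Function.comp_apply, Function.comp_apply, quadStep_quadStep_sub h2 hε hx,
      quadStep_quadStep_sub h2 hε hy]
    refine (norm_quadDisplacement_sub_le h2 hε₀ hε (mapsTo_quadStep_nearOne h2 hε hx)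
      (mapsTo_quadStep_nearOne h2 hε hy)).trans ?_
    exact mul_le_mul_of_nonneg_left (norm_quadStep_sub_quadStep_le h2 hε hx hy) hε₀

end Lipschitz

/-! ### An infinite orbit -/

theorem norm_three_nsmul (x : Fin 4 → ℚ_[3]) : ‖3 • x‖ = 3⁻¹ * ‖x‖ := by
  rw [← Nat.cast_smul_eq_nsmul ℚ_[3], norm_smul]
  congr 1
  simpa using Padic.norm_p (p := 3)

theorem quadStep_iterate_mem_posQuads {S P : ℚ} {x : Fin 4 → ℚ} (hx : x ∈ posQuads ℚ S P) (n : ℕ) :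
    (quadStep ∘ quadStep)^[n] x ∈ posQuads ℚ S P :=
  ((mapsTo_quadStep_posQuads S P).comp (mapsTo_quadStep_posQuads S P)).iterate n hx

theorem cast_quadStep_iterate (x : Fin 4 → ℚ) (n : ℕ) :
    Rat.castHom ℚ_[3] ∘ (quadStep ∘ quadStep)^[n] x =
      (quadStep ∘ quadStep)^[n] (Rat.castHom ℚ_[3] ∘ x) := by
  have h : Function.Semiconj (fun y : Fin 4 → ℚ => Rat.castHom ℚ_[3] ∘ y)
      (quadStep ∘ quadStep) (quadStep ∘ quadStep) := fun y => by
    simp only [Function.comp_apply, map_quadStep]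
  exact h.iterate_right n x

/-- A quadruple of positive rationals that is `3`-adically close to `(1, 1, 1, 1)` and not fixed by
the square of `quadStep` has an infinite orbit. -/
theorem infinite_posQuads {S P : ℚ} {x : Fin 4 → ℚ} (hx : x ∈ posQuads ℚ S P)
    (hx₁ : Rat.castHom ℚ_[3] ∘ x ∈ nearOne ℚ_[3] (3⁻¹ ^ 2)) (hne : quadStep (quadStep x) ≠ x) :
    (posQuads ℚ S P).Infinite := by
  have h2 : ‖(2 : ℚ_[3])‖ = 1 := by
    have := (Padic.norm_natCast_eq_one_iff (p := 3) (n := 2)).2 (by norm_num)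
    simpa using this
  -- Congruence modulo 9 is used because the constant must lie strictly below |3| = 3⁻¹.
  have hf := displacementLipschitz_quadStep (K := ℚ_[3]) (ε := 3⁻¹ ^ 2) h2 (by norm_num)
    (by norm_num)
  have hinj := hf.iterate_pow_injective norm_three_nsmul (by norm_num) (by norm_num) (by norm_num)
    hx₁ (fun h => hne ?_)
  · refine Set.infinite_of_injective_forall_mem (f := fun j => (quadStep ∘ quadStep)^[3 ^ j] x)
      (fun i j hij => hinj ?_) fun j => quadStep_iterate_mem_posQuads hx _
    simp only [← cast_quadStep_iterate] at hij ⊢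
    rw [hij]
  · have h1 := cast_quadStep_iterate x 1
    rw [Function.iterate_one, Function.iterate_one, h, Function.comp_apply] at h1
    exact (Rat.castHom ℚ_[3]).injective.comp_left h1

/-! ### Unordered quadruples and common denominators -/

theorem finite_preimage_multiset {ι α : Type*} [Fintype ι] (s : Multiset α) :
    {x : ι → α | Finset.univ.val.map x = s}.Finite := by
  classical
  refine (Set.Finite.pi' fun _ : ι => s.toFinset.finite_toSet).subset fun x hx i => ?_
  rw [Finset.mem_coe, Multiset.mem_toFinset, ← show _ = s from hx]
  exact Multiset.mem_map_of_mem x (Finset.mem_univ_val i)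

theorem exists_family_distinct_multisets {ι α : Type*} [Fintype ι] {T : Set (ι → α)}
    (hT : T.Infinite) (n : ℕ) : ∃ x : Fin n → ι → α, (∀ i, x i ∈ T) ∧
      Function.Injective fun i => (Finset.univ : Finset ι).val.map (x i) := by
  have hinf : ((fun x : ι → α => Finset.univ.val.map x) '' T).Infinite := fun h =>
    hT ((h.preimage' fun s _ => finite_preimage_multiset s).subset (Set.subset_preimage_image _ T))
  let e := hinf.natEmbedding
  choose x hxT hx using fun i : Fin n => (e i).2
  refine ⟨x, hxT, fun i j hij => ?_⟩
  simp only [hx] at hij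
  exact Fin.ext (e.injective (Subtype.ext hij))

theorem exists_common_denominator {ι κ : Type*} [Fintype ι] [Fintype κ] (x : ι → κ → ℚ) :
    ∃ D : ℕ, 0 < D ∧ ∀ i j, ∃ z : ℤ, (D : ℚ) * x i j = z := by
  refine ⟨∏ p : ι × κ, (x p.1 p.2).den, Finset.prod_pos fun p _ => (x p.1 p.2).den_pos,
    fun i j => ?_⟩
  obtain ⟨m, hm⟩ := Finset.dvd_prod_of_mem (fun p : ι × κ => (x p.1 p.2).den)
    (Finset.mem_univ (i, j))
  refine ⟨m * (x i j).num, ?_⟩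
  rw [hm]
  push_cast
  rw [mul_comm ((x i j).den : ℚ), mul_assoc, Rat.den_mul_eq_num]

/-! ### The bound on the entries and the starting point -/

/-- If the product of four positive numbers is large compared with their sum, then
each of them is less than half the sum. -/
theorem lt_half_sum_of_prod {S x y z w : ℚ} (hx : 0 < x) (hy : 0 < y) (hz : 0 < z) (hw : 0 < w)
    (hS : x + y + z + w = S) (hP : S ^ 4 < 432 * (x * y * z * w)) : x < S / 2 := by
  -- If x ≥ u, where u is the sum of the other three, AM-GM bounds the product by x * u ^ 3 / 27,
  -- which for fixed x + u = S is largest at x = u = S / 2, with value S ^ 4 / 432.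
  by_contra! h
  set u := y + z + w with hu
  have hu0 : 0 < u := by positivity
  have hux : u ≤ x := by linarith
  have hamgm : 27 * (y * z * w) ≤ u ^ 3 := by
    rw [hu]
    nlinarith [mul_nonneg hy.le (sq_nonneg (z - w)), mul_nonneg hz.le (sq_nonneg (y - w)),
      mul_nonneg hw.le (sq_nonneg (y - z)), mul_nonneg hy.le (sq_nonneg (y - w)),
      mul_nonneg (add_nonneg (add_nonneg hy.le hz.le) hw.le)
        (add_nonneg (add_nonneg (sq_nonneg (y - z)) (sq_nonneg (z - w))) (sq_nonneg (y - w)))]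
  have h1 : 432 * (x * y * z * w) ≤ 16 * x * u ^ 3 := by
    nlinarith [mul_le_mul_of_nonneg_left hamgm hx.le]
  have h2 : 16 * x * u ^ 3 ≤ (x + u) ^ 4 := by
    have e : (x + u) ^ 4 - 16 * x * u ^ 3 =
        (x - u) ^ 4 + 8 * x * u * ((x - u) * (x + u)) := by ring
    have : 0 ≤ (x - u) * (x + u) := mul_nonneg (by linarith) (by linarith)
    have : 0 ≤ (x - u) ^ 4 + 8 * x * u * ((x - u) * (x + u)) := by positivity
    linarith
  have h3 : x + u = S := by rw [← hS, hu]; ring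
  rw [h3] at h2
  linarith

theorem posQuads_lt_half {S P : ℚ} (hSP : S ^ 4 < 432 * P) {x : Fin 4 → ℚ}
    (hx : x ∈ posQuads ℚ S P) (i : Fin 4) : x i < S / 2 := by
  obtain ⟨hx, hS, rfl⟩ := hx
  rw [Fin.sum_univ_four] at hS
  rw [Fin.prod_univ_four] at hSP
  match i with
  | 0 => exact lt_half_sum_of_prod (hx 0) (hx 1) (hx 2) (hx 3) hS hSP
  | 1 => exact lt_half_sum_of_prod (hx 1) (hx 0) (hx 2) (hx 3) (by linarith) (by linarith)
  | 2 => exact lt_half_sum_of_prod (hx 2) (hx 0) (hx 1) (hx 3) (by linarith) (by linarith)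
  | 3 => exact lt_half_sum_of_prod (hx 3) (hx 0) (hx 1) (hx 2) (by linarith) (by linarith)

/-- The entries are the squares of 17, 19, 26, 28, all ±1 modulo 9, so they are congruent to 1
modulo 9 and their product is a square. -/
theorem infinite_posQuads_concrete : (posQuads ℚ 2110 (235144 ^ 2)).Infinite := by
  refine infinite_posQuads (x := ![289, 361, 676, 784]) ⟨?_, ?_, ?_⟩ ?_ ?_
  · intro i; fin_cases i <;> norm_num
  · simp [Fin.sum_univ_four]; norm_num
  · simp [Fin.prod_univ_four]; norm_num
  · intro i
    have h (k : ℤ) : ‖((9 * k : ℤ) : ℚ_[3])‖ ≤ 3⁻¹ ^ 2 := by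
      have := (Padic.norm_int_le_pow_iff_dvd (p := 3) (9 * k) 2).2 ⟨k, by norm_num⟩
      refine this.trans (by norm_num)
    fin_cases i
    · exact (congrArg norm (by simp; norm_num)).trans_le (h 32)
    · exact (congrArg norm (by simp; norm_num)).trans_le (h 40)
    · exact (congrArg norm (by simp; norm_num)).trans_le (h 75)
    · exact (congrArg norm (by simp; norm_num)).trans_le (h 87)
  · intro h
    have := congrFun h 0
    simp [quadStep] at this
    norm_num at this

/-! ### From quadruples to quadrilaterals -/

namespace Quadrilateral

/-- The cyclic quadrilateral whose sides are `D` times the numbers `h - x j`, where `2 * h` is the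
sum of the four positive numbers `x j`. -/
theorem exists_isCyclicQuad_of_posQuads {D : ℝ} (hD : 0 < D) {h r : ℝ} (hr : 0 ≤ r)
    {x : Fin 4 → ℝ} (hx : x ∈ posQuads ℝ (2 * h) (r ^ 2)) (hlt : ∀ j, x j < h) :
    ∃ Q : Polygon Plane 4, IsCyclicQuad Q ∧ (∀ j, side Q j = D * (h - x j)) ∧
      area Q = ENNReal.ofReal (D ^ 2 * r) := by
  obtain ⟨hx, hS, hP⟩ := hx
  rw [Fin.sum_univ_four] at hS
  rw [Fin.prod_univ_four] at hP
  have hpos (j : Fin 4) : 0 < D * (h - x j) := mul_pos hD (sub_pos.2 (hlt j))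
  have hDx (j : Fin 4) : 0 < D * x j := mul_pos hD (hx j)
  have hDS := congrArg (D * ·) hS
  simp only [mul_add] at hDS
  obtain ⟨Q, hQ, h0, h1, h2, h3, hA⟩ := exists_isCyclicQuad (hpos 0) (hpos 1) (hpos 2) (hpos 3)
    (by linarith [hDx 0]) (by linarith [hDx 1]) (by linarith [hDx 2]) (by linarith [hDx 3])
  refine ⟨Q, hQ, fun j => by fin_cases j <;> assumption, ?_⟩
  rw [hA]
  congr 1
  have e0 : D * (h - x 1) + D * (h - x 2) + D * (h - x 3) - D * (h - x 0) = 2 * (D * x 0) := by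
    linarith
  have e1 : D * (h - x 0) + D * (h - x 2) + D * (h - x 3) - D * (h - x 1) = 2 * (D * x 1) := by
    linarith
  have e2 : D * (h - x 0) + D * (h - x 1) + D * (h - x 3) - D * (h - x 2) = 2 * (D * x 2) := by
    linarith
  have e3 : D * (h - x 0) + D * (h - x 1) + D * (h - x 2) - D * (h - x 3) = 2 * (D * x 3) := by
    linarith
  have e : 2 * (D * x 0) * (2 * (D * x 1)) * (2 * (D * x 2)) * (2 * (D * x 3)) =
      (4 * D ^ 2 * r) ^ 2 := by
    linear_combination 16 * D ^ 4 * hP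
  rw [e0, e1, e2, e3, e, Real.sqrt_sq (by positivity)]
  ring

end Quadrilateral

theorem mainTheorem3 (n : ℕ) (hn : 0 < n) :
    ∃ (Q : Fin n → Polygon Plane 4) (p A : ℕ),
      (∀ i, Quadrilateral.IsCyclicQuad (Q i) ∧
        (∀ j, ∃ a : ℕ, Quadrilateral.side (Q i) j = (a : ℝ)) ∧
        Quadrilateral.perimeter (Q i) = (p : ℝ) ∧
        Quadrilateral.area (Q i) = (A : ENNReal)) ∧
      ∀ i i', i ≠ i' → Quadrilateral.sides (Q i) ≠ Quadrilateral.sides (Q i') := by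
  obtain ⟨x, hxT, hinj⟩ := exists_family_distinct_multisets infinite_posQuads_concrete n
  obtain ⟨D, hD, hDx⟩ := exists_common_denominator x
  have hD' : (0 : ℝ) < D := Nat.cast_pos.2 hD
  have hlt (i : Fin n) (j : Fin 4) : x i j < 1055 := by
    have := posQuads_lt_half (by norm_num) (hxT i) j
    norm_num at this
    exact this
  have hQ (i : Fin n) := Quadrilateral.exists_isCyclicQuad_of_posQuads hD' (h := 1055)
    (r := 235144) (by norm_num) (x := fun j => (x i j : ℝ)) (by
      obtain ⟨h1, h2, h3⟩ := hxT i
      refine ⟨fun j => Rat.cast_pos.2 (h1 j), ?_, ?_⟩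
      · rw [← Rat.cast_sum, h2]; norm_num
      · rw [← Rat.cast_prod, h3]; norm_num) (fun j => by exact_mod_cast hlt i j)
  choose Q hcyc hside harea using hQ
  -- The perimeter is D * (4 * 1055 - 2110).
  refine ⟨Q, 2110 * D, D ^ 2 * 235144, fun i => ⟨hcyc i, fun j => ?_, ?_, ?_⟩, ?_⟩
  · obtain ⟨z, hz⟩ := hDx i j
    have hz' : (D : ℝ) * x i j = z := by exact_mod_cast hz
    have hs : Quadrilateral.side (Q i) j = ((D * 1055 - z : ℤ) : ℝ) := by
      rw [hside]; push_cast; rw [← hz']; ring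
    have h0 : (0 : ℤ) ≤ D * 1055 - z := by
      have : (0 : ℝ) ≤ ((D * 1055 - z : ℤ) : ℝ) := hs ▸ dist_nonneg
      exact_mod_cast this
    lift (D * 1055 - z : ℤ) to ℕ using h0 with a
    exact ⟨a, by rw [hs]; simp⟩
  · have h2 : ∑ j, (x i j : ℝ) = 2110 := by
      rw [← Rat.cast_sum, (hxT i).2.1]; norm_num
    simp only [Quadrilateral.perimeter, hside, ← Finset.mul_sum, Finset.sum_sub_distrib, h2]
    simp
    ring
  · rw [harea, ← ENNReal.ofReal_natCast]
    push_cast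
    rfl
  · intro i i' hne heq
    refine hne (hinj ?_)
    -- The sides are the image of the quadruple under an injective affine map, so equal side
    -- multisets force equal multisets of entries.
    have hmap (i : Fin n) : Quadrilateral.sides (Q i) =
        (Finset.univ.val.map (x i)).map fun t : ℚ => (D : ℝ) * (1055 - t) := by
      rw [Quadrilateral.sides, Multiset.map_map]
      exact Multiset.map_congr rfl fun j _ => hside i j
    rw [hmap, hmap] at heq
    refine Multiset.map_injective (fun s t hst => ?_) heq
    have := mul_left_cancel₀ hD'.ne' hst
    exact_mod_cast sub_right_injective this
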